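/- Let $\mathbb{U}=\{z\in\mathbb{C}:|z|<1\}$. Let $\mathcal{H}$ be the class of complex-valued harmonic functions $f=h+\overline{g}$ in $\mathbb{U}$, with $h,g$ analytic in $\mathbb{U}$, normalized by $f(0)=h(0)=0$ and $h'(0)=1$, so that $$f(z)=h(z)+\overline{g(z)}=z+\sum_{n=2}^{\infty}a_nz^n+\overline{\sum_{n=1}^{\infty}b_nz^n},\qquad a_1=1 .$$ Let $J_f=|h'|^2-|g'|^2$ denote the Jacobian of $f$. Let $\mathcal{S}_{\mathcal{H}}$ be the class of $f\in\mathcal{H}$ that are univalent (injective) and sense-preserving ($J_f>0$) in $\mathbb{U}$. A domain $D\subset\mathbb{C}$ is called close-to-convex if its complement can be written as a union of half-lines that are pairwise non-intersecting, except that the origin of one half-line may lie on another one. Let $\mathcal{C}_{\mathcal{H}}$ be the class of $f\in\mathcal{S}_{\mathcal{H}}$ for which $f(\mathbb{U})$ is a close-to-convex domain. **Theorem.** Let $f\in\mathcal{H}$ be locally univalent in $\mathbb{U}$ (every point of $\mathbb{U}$ has a neighbourhood on which $f$ is injective) and not orientation-reversing, in the sense that $J_f\ge 0$ throughout $\mathbb{U}$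 (in particular this holds if $f$ is sense-preserving). Suppose that for some real numbers $\alpha$ and $\beta$ $$\sum_{n=2}^{\infty}\left[\left|\sum_{k=1}^{n}\left\{\sum_{j=1}^{k}(-1)^{k-j}j(j+1)\binom{\alpha}{k-j}a_j\right\}\binom{\beta}{n-k}\right|+\left|\sum_{k=1}^{n}\left\{\sum_{j=1}^{k}(-1)^{k-j}j(j-1)\binom{\alpha}{k-j}a_j\right\}\binom{\beta}{n-k}\right|\right]\le 2,$$ where $\binom{x}{m}=\frac{x(x-1)\cdots(x-m+1)}{m!}$. Then $f\in\mathcal{C}_{\mathcal{H}}$. -/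

import Mathlib

noncomputable section

namespace HarmonicCTC

/-- The open unit disk. -/
def unitDisk : Set ℂ := Metric.ball 0 1

/-- `f` is a normalized harmonic function in the unit disk with analytic part `h` and co-analytic
part `g`: `f = h + conj g` in the disk, with `f 0 = h 0 = 0` and `h' 0 = 1`. -/
structure IsNormalizedHarmonic (f h g : ℂ → ℂ) : Prop where
  harmonic : InnerProductSpace.HarmonicOnNhd f unitDisk
  analytic_h : AnalyticOnNhd ℂ h unitDisk
  analytic_g : AnalyticOnNhd ℂ g unitDisk
  eq_add_conj : ∀ z ∈ unitDisk, f z = h z + (starRingEnd ℂ) (g z)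
  f_zero : f 0 = 0
  h_zero : h 0 = 0
  deriv_h_zero : deriv h 0 = 1

/-- The class `𝓗` of normalized harmonic functions in the unit disk. -/
def classH : Set (ℂ → ℂ) := {f | ∃ h g : ℂ → ℂ, IsNormalizedHarmonic f h g}

/-- Local univalence: every point of the disk has a neighbourhood on which `f` is injective. -/
def LocallyUnivalent (f : ℂ → ℂ) : Prop :=
  ∀ z ∈ unitDisk, ∃ V : Set ℂ, IsOpen V ∧ z ∈ V ∧ V ⊆ unitDisk ∧ Set.InjOn f V

/-- The Jacobian determinant of `f`, as a map of the real plane, at `z`. -/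
def jacobian (f : ℂ → ℂ) (z : ℂ) : ℝ := (fderiv ℝ f z).det

/-- Sense-preserving in the disk: the Jacobian is positive at every point. -/
def SensePreserving (f : ℂ → ℂ) : Prop := ∀ z ∈ unitDisk, 0 < jacobian f z

/-- The class `𝓢_𝓗`: univalent and sense-preserving functions of `𝓗`. -/
def classSH : Set (ℂ → ℂ) := {f | f ∈ classH ∧ Set.InjOn f unitDisk ∧ SensePreserving f}

/-- The closed half-line with origin `p` in the direction `d`. -/
def halfLine (p d : ℂ) : Set ℂ := {w | ∃ t : ℝ, 0 ≤ t ∧ w = p + (t : ℂ) * d}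

/-- A close-to-convex domain: a domain whose complement is a union of half-lines (coded by origin
and unit direction) any two of which are disjoint, except that the origin of one of the two
may lie on the other. -/
def IsCloseToConvexDomain (D : Set ℂ) : Prop :=
  IsOpen D ∧ IsConnected D ∧
    ∃ R : Set (ℂ × ℂ),
      (∀ r ∈ R, ‖r.2‖ = 1) ∧
      Dᶜ = ⋃ r ∈ R, halfLine r.1 r.2 ∧
      R.Pairwise fun r s =>
        halfLine r.1 r.2 ∩ halfLine s.1 s.2 ⊆ {r.1} ∨ halfLine r.1 r.2 ∩ halfLine s.1 s.2 ⊆ {s.1}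

/-- The class `𝓒_𝓗`: functions of `𝓢_𝓗` mapping the disk onto a close-to-convex domain. -/
def classCH : Set (ℂ → ℂ) := {f | f ∈ classSH ∧ IsCloseToConvexDomain (f '' unitDisk)}

/-- The `n`-th Taylor coefficient of `h` at the origin. -/
def taylorCoeff (h : ℂ → ℂ) (n : ℕ) : ℂ := iteratedDeriv n h 0 / (n.factorial : ℂ)

/-- The double sum `∑_{k=1}^n (∑_{j=1}^k (-1)^{k-j} w_j binom(α, k-j) a_j) binom(β, n-k)`,
with generalized binomial coefficients. -/
def doubleSum (α β : ℝ) (w a : ℕ → ℂ) (n : ℕ) : ℂ :=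
  ∑ k ∈ Finset.Icc 1 n,
    (∑ j ∈ Finset.Icc 1 k,
      (-1 : ℂ) ^ (k - j) * w j * ((Ring.choose α (k - j) : ℝ) : ℂ) * a j) *
      ((Ring.choose β (n - k) : ℝ) : ℂ)

/-- The `n`-th term of the series in the coefficient condition. -/
def coeffTerm (α β : ℝ) (a : ℕ → ℂ) (n : ℕ) : ℝ :=
  ‖doubleSum α β (fun j => (j : ℂ) * ((j : ℂ) + 1)) a n‖ +
    ‖doubleSum α β (fun j => (j : ℂ) * ((j : ℂ) - 1)) a n‖

end HarmonicCTC

end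

/-! The double sums are the Taylor coefficients of `(z² h'' + 2 z h') A B` and `z² h'' A B`, where
`A` and `B` are the binomial series of `(1 - z)^α` and `(1 + z)^β`. Their linear coefficients are 2
and 0, so the hypothesis forces the second product to be strictly smaller in modulus than the first
for `0 < |z| < 1`. Cancelling the common factor gives `|z h''| < |z h'' + 2 h'|`, that is `Re (1 + z
h'' / h') > 0`, and `h` is univalent with convex image `Ω` (`injOn_of_re_pos`,
`convex_image_of_re_pos`).

Local univalence and the maximum principle give `|g'| < |h'|`. In the coordinate `w = h z` the map
`f` becomes `w + ψ w`, where `ψ` is the conjugate of `g ∘ h⁻¹`, a strict contraction of the convex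
set `Ω`. Injectivity of `f` is then immediate.

Close-to-convexity comes from monotone operators. Extend `ψ` to the closure of `Ω`, let `P` be the
metric projection onto that closure and put `T = ψ ∘ P`. The outward normal rays of `Ω`, translated
by `ψ` of their foot, fill the part of the range of `1 + T` outside the image. Points missed by `1 +
T` are covered by normal rays to the closure of that range (`exists_outer_normal_of_notMem_range`).
Monotonicity of normals keeps distinct rays apart except at origins. -/

open scoped RealInnerProductSpace Topology
open Filter

namespace HarmonicCTC

/-! ### Monotone operators and projections in inner product spaces -/

section Monotone

variable {E : Type*} [NormedAddCommGroup E] [InnerProductSpace ℝ E]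

/-- The identity plus a nonexpansive map is a monotone operator. -/
theorem inner_add_nonexpansive_nonneg {T : E → E} (hT : ∀ a b, ‖T a - T b‖ ≤ ‖a - b‖) (a b : E) :
    0 ≤ ⟪a + T a - (b + T b), a - b⟫ := by
  have h1 : a + T a - (b + T b) = (a - b) + (T a - T b) := by abel
  rw [h1, inner_add_left, real_inner_self_eq_norm_sq]
  have h2 := (abs_le.1 (abs_real_inner_le_norm (T a - T b) (a - b))).1
  nlinarith [hT a b, norm_nonneg (a - b)]

/-- The regularized equation `w + T w + ε w = y` is solvable. -/
theorem exists_regularized_solution [CompleteSpace E] {T : E → E}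
    (hT : ∀ a b, ‖T a - T b‖ ≤ ‖a - b‖) {ε : ℝ} (hε : 0 < ε) (y : E) :
    ∃ w, w + T w + ε • w = y := by
  have hpos : 0 < 1 + ε := by linarith
  -- The equation says that `w` is a fixed point of `w ↦ (y - T w) / (1 + ε)`.
  have hc : ContractingWith (Real.toNNReal (1 + ε)⁻¹) (fun w => (1 + ε)⁻¹ • (y - T w)) := by
    refine ⟨?_, LipschitzWith.of_dist_le_mul fun a b => ?_⟩
    · rw [Real.toNNReal_lt_one]
      exact inv_lt_one_of_one_lt₀ (by linarith)
    · rw [Real.coe_toNNReal _ (by positivity), dist_eq_norm, dist_eq_norm, ← smul_sub, norm_smul,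
        Real.norm_of_nonneg (by positivity)]
      have : y - T a - (y - T b) = T b - T a := by abel
      rw [this, norm_sub_rev a b]
      gcongr
      exact hT b a
  refine ⟨ContractingWith.fixedPoint _ hc, ?_⟩
  have h := hc.fixedPoint_isFixedPt
  set w := ContractingWith.fixedPoint _ hc
  have h' : (1 + ε)⁻¹ • (y - T w) = w := h
  have h2 : y - T w = (1 + ε) • w := by
    rw [← h', smul_smul, mul_inv_cancel₀ hpos.ne', one_smul, h']
  rw [add_smul, one_smul] at h2
  have : w + T w + ε • w = T w + (w + ε • w) := by abel
  rw [this, ← h2]; abel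

/-- A point outside the range of the identity plus a nonexpansive map lies on a half-line that
starts at the closure of the range, in the direction of an outer normal. -/
theorem exists_outer_normal_of_notMem_range [ProperSpace E] {T : E → E}
    (hT : ∀ a b, ‖T a - T b‖ ≤ ‖a - b‖) {y : E} (hy : y ∉ Set.range fun w => w + T w) :
    ∃ q e : E, ‖e‖ = 1 ∧ q ∈ closure (Set.range fun w => w + T w) ∧
      (∀ v, ⟪v + T v - q, e⟫ ≤ 0) ∧ ∃ s : ℝ, 0 ≤ s ∧ y = q + s • e := by
  have hTc : Continuous T :=
    (LipschitzWith.of_dist_le_mul (K := 1) fun a b => by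
      simpa [dist_eq_norm] using hT a b).continuous
  have hex : ∀ n : ℕ, ∃ w, w + T w + (1 / ((n : ℝ) + 1)) • w = y := fun n =>
    exists_regularized_solution hT (by positivity) y
  choose w hw using hex
  set ε : ℕ → ℝ := fun n => 1 / ((n : ℝ) + 1) with hεdef
  have hεpos : ∀ n, 0 < ε n := fun n => by simp only [hεdef]; positivity
  have hw' : ∀ n, w n + T (w n) = y - ε n • w n := fun n => by
    rw [eq_sub_iff_add_eq]; exact hw n
  have hmono : ∀ n v, 0 ≤ ⟪y - ε n • w n - (v + T v), w n - v⟫ := fun n v => by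
    rw [← hw']; exact inner_add_nonexpansive_nonneg hT _ _
  -- Monotonicity against `v = 0` bounds `ε w`, although `w` itself may escape to infinity.
  have hub : ∀ n, ‖ε n • w n‖ ≤ ‖y - T 0‖ := fun n => by
    have h := mul_nonneg (hεpos n).le (hmono n 0)
    rw [← real_inner_smul_right, sub_zero, zero_add] at h
    have h1 : y - ε n • w n - T 0 = (y - T 0) - ε n • w n := by abel
    rw [h1, inner_sub_left, real_inner_self_eq_norm_sq] at h
    have h2 := real_inner_le_norm (y - T 0) (ε n • w n)
    by_contra hcon
    push Not at hcon
    nlinarith [norm_nonneg (y - T 0)]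
  -- Limits along a nonprincipal ultrafilter replace successive passages to subsequences.
  let F : Ultrafilter ℕ := hyperfilter ℕ
  have hF : (F : Filter ℕ) ≤ atTop := by
    rw [← Nat.cofinite_eq_atTop]; exact hyperfilter_le_cofinite
  have hlim : ∀ (x : ℕ → E) (M : ℝ), (∀ᶠ n in F, ‖x n‖ ≤ M) → ∃ a, Tendsto x F (𝓝 a) := by
    intro x M hx
    obtain ⟨a, -, ha⟩ := (isCompact_closedBall (0 : E) M).ultrafilter_le_nhds (F.map x)
      (by
        rw [Ultrafilter.coe_map, le_principal_iff, mem_map]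
        filter_upwards [hx] with n hn
        simpa using hn)
    exact ⟨a, ha⟩
  obtain ⟨u, hu⟩ := hlim (fun n => ε n • w n) _ (Eventually.of_forall hub)
  have hΦlim : Tendsto (fun n => w n + T (w n)) F (𝓝 (y - u)) := by
    simp_rw [hw']; exact tendsto_const_nhds.sub hu
  have hε0 : Tendsto ε F (𝓝 0) := tendsto_one_div_add_atTop_nhds_zero_nat.mono_left hF
  -- A bounded family would converge to a solution of `w + T w = y`, which is excluded.
  have hbig : ∀ M : ℝ, ∀ᶠ n in F, M ≤ ‖w n‖ := by
    intro M
    by_contra hcon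
    have hle : ∀ᶠ n in F, ‖w n‖ ≤ M := by
      have := Ultrafilter.eventually_not.2 hcon
      filter_upwards [this] with n hn using (not_le.1 hn).le
    obtain ⟨a, ha⟩ := hlim w M hle
    have hu0 : u = 0 := tendsto_nhds_unique hu (by simpa using hε0.smul ha)
    refine hy ⟨a, ?_⟩
    have := tendsto_nhds_unique hΦlim (ha.add ((hTc.tendsto a).comp ha))
    simp only [hu0, sub_zero] at this
    exact this.symm
  have htop : Tendsto (fun n => ‖w n‖) F atTop := tendsto_atTop.2 hbig
  have hinv : Tendsto (fun n => ‖w n‖⁻¹) F (𝓝 0) := tendsto_inv_atTop_zero.comp htop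
  have hunit : ∀ᶠ n in F, ‖‖w n‖⁻¹ • w n‖ = 1 := by
    filter_upwards [hbig 1] with n hn
    rw [norm_smul, norm_inv, norm_norm, inv_mul_cancel₀ (by linarith)]
  obtain ⟨e, he⟩ := hlim (fun n => ‖w n‖⁻¹ • w n) 1 (hunit.mono fun n hn => hn.le)
  have hue : u = ‖u‖ • e := by
    refine tendsto_nhds_unique hu ((hu.norm.smul he).congr' ?_)
    filter_upwards [hbig 1] with n hn
    rw [norm_smul, Real.norm_of_nonneg (hεpos n).le, smul_smul, mul_assoc,
      mul_inv_cancel₀ (by linarith), mul_one]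
  refine ⟨y - u, e, ?_, ?_, fun v => ?_, ‖u‖, norm_nonneg _, ?_⟩
  · exact tendsto_nhds_unique he.norm (tendsto_const_nhds.congr' (hunit.mono fun n hn => hn.symm))
  · exact mem_closure_of_tendsto hΦlim (Eventually.of_forall fun n => ⟨w n, rfl⟩)
  -- Dividing the monotonicity inequality by `‖w n‖` removes the contribution of `v` on the right in
  -- the limit, leaving the normal direction `e`.
  · have h1 : Tendsto (fun n => ⟪y - ε n • w n - (v + T v), ‖w n‖⁻¹ • w n - ‖w n‖⁻¹ • v⟫) F
        (𝓝 ⟪y - u - (v + T v), e - (0 : ℝ) • v⟫) :=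
      ((tendsto_const_nhds.sub hu).sub tendsto_const_nhds).inner
        (he.sub (hinv.smul tendsto_const_nhds))
    have h2 := ge_of_tendsto h1 (b := 0) (Eventually.of_forall fun n => by
      rw [← smul_sub, real_inner_smul_right]
      exact mul_nonneg (by positivity) (hmono n v))
    rw [zero_smul, sub_zero] at h2
    have h3 : v + T v - (y - u) = -(y - u - (v + T v)) := by abel
    rw [h3, inner_neg_left]
    linarith
  · rw [← hue]; abel

/-- Comparison of two points with their projections onto a convex set. -/
theorem norm_sub_sq_add_le_of_normal {p₁ p₂ a₁ a₂ : E} (h₁ : ⟪a₁, p₂ - p₁⟫ ≤ 0)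
    (h₂ : ⟪a₂, p₁ - p₂⟫ ≤ 0) :
    ‖p₁ - p₂‖ ^ 2 + ‖a₁ - a₂‖ ^ 2 ≤ ‖p₁ + a₁ - (p₂ + a₂)‖ ^ 2 := by
  -- The hypotheses make the cross term of the expanded square nonnegative.
  have h : p₁ + a₁ - (p₂ + a₂) = (p₁ - p₂) + (a₁ - a₂) := by abel
  rw [h, norm_add_sq_real, inner_sub_right, real_inner_comm a₁, real_inner_comm a₂]
  rw [← neg_sub, inner_neg_right] at h₁
  linarith

/-- Existence of the metric projection, in variational form. -/
theorem exists_projection {K : Set E} (hK : IsComplete K) (hconv : Convex ℝ K)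
    (hne : K.Nonempty) (w : E) : ∃ p ∈ K, ∀ c ∈ K, ⟪w - p, c - p⟫ ≤ 0 := by
  obtain ⟨p, hp, h⟩ := exists_norm_eq_iInf_of_complete_convex hne hK hconv w
  exact ⟨p, hp, (norm_eq_iInf_iff_real_inner_le_zero hconv hp).1 h⟩

/-- A closed half-space whose boundary passes through the point `q` contains an open set only
if the open set misses the boundary. -/
theorem inner_lt_of_isOpen {D : Set E} (hD : IsOpen D) {q e : E} (he : e ≠ 0)
    (h : ∀ d ∈ D, ⟪d - q, e⟫ ≤ 0) {d : E} (hd : d ∈ D) : ⟪d - q, e⟫ < 0 := by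
  have hcont : Tendsto (fun t : ℝ => d + t • e) (𝓝[>] 0) (𝓝 d) := by
    have : Continuous fun t : ℝ => d + t • e := by fun_prop
    simpa using (this.tendsto 0).mono_left nhdsWithin_le_nhds
  obtain ⟨t, htD, ht⟩ := ((hcont.eventually (hD.mem_nhds hd)).and self_mem_nhdsWithin).exists
  have ht : 0 < t := ht
  have h1 := h _ htD
  have h2 : d + t • e - q = (d - q) + t • e := by abel
  rw [h2, inner_add_left, real_inner_smul_left, real_inner_self_eq_norm_sq] at h1
  have : 0 < t * ‖e‖ ^ 2 := by positivity
  linarith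

/-- Supporting hyperplanes of open convex sets. -/
theorem exists_normal_of_notMem [CompleteSpace E] {Ω : Set E} (hΩ : IsOpen Ω)
    (hconv : Convex ℝ Ω) (hne : Ω.Nonempty) {p : E} (hp : p ∉ Ω) :
    ∃ e : E, ‖e‖ = 1 ∧ ∀ c ∈ Ω, ⟪e, c - p⟫ ≤ 0 := by
  obtain ⟨l, hl⟩ := geometric_hahn_banach_open_point hconv hΩ hp
  set a := (InnerProductSpace.toDual ℝ E).symm l with ha
  have hla : ∀ x, l x = ⟪a, x⟫ := fun x => by rw [ha, InnerProductSpace.toDual_symm_apply]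
  have ha0 : a ≠ 0 := by
    rintro h0
    obtain ⟨c, hc⟩ := hne
    have := hl c hc
    rw [hla, hla, h0] at this
    simp at this
  refine ⟨‖a‖⁻¹ • a, ?_, fun c hc => ?_⟩
  · rw [norm_smul, norm_inv, norm_norm, inv_mul_cancel₀ (norm_ne_zero_iff.2 ha0)]
  · rw [real_inner_smul_left, inner_sub_right, ← hla, ← hla]
    exact mul_nonpos_of_nonneg_of_nonpos (by positivity) (by linarith [hl c hc])

end Monotone

/-! ### Normal rays and close-to-convex images -/

theorem add_smul_mem_halfLine (p d : ℂ) {t : ℝ} (ht : 0 ≤ t) : p + t • d ∈ halfLine p d :=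
  ⟨t, ht, by rw [Complex.real_smul]⟩

theorem exists_of_mem_halfLine {p d w : ℂ} (h : w ∈ halfLine p d) :
    ∃ t : ℝ, 0 ≤ t ∧ w = p + t • d := by
  obtain ⟨t, ht, rfl⟩ := h
  exact ⟨t, ht, by rw [Complex.real_smul]⟩

/-- The outward normal directions of a set at one of its points. -/
def IsNormal (K : Set ℂ) (p a : ℂ) : Prop := ∀ c ∈ K, ⟪a, c - p⟫ ≤ 0

theorem IsNormal.smul {K : Set ℂ} {p a : ℂ} (h : IsNormal K p a) {t : ℝ} (ht : 0 ≤ t) :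
    IsNormal K p (t • a) := fun c hc => by
  rw [real_inner_smul_left]
  exact mul_nonpos_of_nonneg_of_nonpos ht (h c hc)

theorem isNormal_closure {Ω : Set ℂ} {p a : ℂ} (h : IsNormal Ω p a) :
    IsNormal (closure Ω) p a := fun c hc => by
  have hcl : IsClosed {c : ℂ | ⟪a, c - p⟫ ≤ 0} :=
    isClosed_le (by fun_prop) continuous_const
  exact closure_minimal h hcl hc

/-- Two normals at points moved by a nonexpansive map reach the same point only if they agree. -/
theorem IsNormal.eq_of_add_eq {K : Set ℂ} {ψ : ℂ → ℂ}
    (hle : ∀ a ∈ K, ∀ b ∈ K, ‖ψ a - ψ b‖ ≤ ‖a - b‖) {p₁ p₂ a₁ a₂ : ℂ} (hp₁ : p₁ ∈ K)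
    (hp₂ : p₂ ∈ K) (h₁ : IsNormal K p₁ a₁) (h₂ : IsNormal K p₂ a₂)
    (h : p₁ + ψ p₁ + a₁ = p₂ + ψ p₂ + a₂) : a₁ = a₂ := by
  have hsq := norm_sub_sq_add_le_of_normal (h₁ p₂ hp₂) (h₂ p₁ hp₁)
  -- The right side of `hsq` becomes `‖ψ p₁ - ψ p₂‖²`, at most `‖p₁ - p₂‖²`, which leaves no room
  -- for `a₁ - a₂`.
  have he : p₁ + a₁ - (p₂ + a₂) = -(ψ p₁ - ψ p₂) := by linear_combination h
  rw [he, norm_neg] at hsq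
  have := hle p₁ hp₁ p₂ hp₂
  have h0 : ‖a₁ - a₂‖ ^ 2 ≤ 0 := by nlinarith [norm_nonneg (ψ p₁ - ψ p₂)]
  exact sub_eq_zero.1 (norm_eq_zero.1 (pow_eq_zero_iff (two_ne_zero)|>.1
    (le_antisymm h0 (sq_nonneg _))))

/-- Half-lines with unit directions that are determined by their points meet only at a
common origin. -/
theorem halfLine_inter_subset_of_smul_eq {r s : ℂ × ℂ} (hr : ‖r.2‖ = 1) (hs : ‖s.2‖ = 1)
    (hrs : r ≠ s)
    (h : ∀ t u : ℝ, 0 ≤ t → 0 ≤ u → r.1 + t • r.2 = s.1 + u • s.2 → t • r.2 = u • s.2) :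
    halfLine r.1 r.2 ∩ halfLine s.1 s.2 ⊆ {r.1} := by
  rintro w ⟨hw₁, hw₂⟩
  obtain ⟨t, ht, rfl⟩ := exists_of_mem_halfLine hw₁
  obtain ⟨u, hu, hwu⟩ := exists_of_mem_halfLine hw₂
  have heq := h t u ht hu hwu
  have htu : t = u := by
    have := congrArg norm heq
    rwa [norm_smul, norm_smul, hr, hs, mul_one, mul_one, Real.norm_of_nonneg ht,
      Real.norm_of_nonneg hu] at this
  subst htu
  rcases ht.eq_or_lt with h0 | h0
  · simp [← h0]
  · exact absurd (Prod.ext (by rw [heq] at hwu; exact add_right_cancel hwu)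
      (smul_right_injective ℂ h0.ne' heq)) hrs

/-- The identity plus a strict contraction maps an open convex set onto a close-to-convex
domain, as soon as the image is open. Version for contractions defined on the closure. -/
theorem isCloseToConvexDomain_image_of_closure {Ω : Set ℂ} (hΩ : IsOpen Ω) (hconv : Convex ℝ Ω)
    (hne : Ω.Nonempty) {ψ : ℂ → ℂ}
    (hle : ∀ a ∈ closure Ω, ∀ b ∈ closure Ω, ‖ψ a - ψ b‖ ≤ ‖a - b‖)
    (hlt : ∀ a ∈ Ω, ∀ b ∈ Ω, a ≠ b → ‖ψ a - ψ b‖ < ‖a - b‖)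
    (hD : IsOpen ((fun w => w + ψ w) '' Ω)) :
    IsCloseToConvexDomain ((fun w => w + ψ w) '' Ω) := by
  set K := closure Ω with hK
  have hΩK : Ω ⊆ K := subset_closure
  choose P hPK hPn using exists_projection isClosed_closure.isComplete hconv.closure hne.closure
  have hPN : ∀ w, IsNormal K (P w) (w - P w) := hPn
  have hPcontr : ∀ a b, ‖P a - P b‖ ≤ ‖a - b‖ := fun a b => by
    have h := norm_sub_sq_add_le_of_normal (hPn a _ (hPK b)) (hPn b _ (hPK a))
    simp only [add_sub_cancel] at h
    exact le_of_sq_le_sq (by nlinarith [sq_nonneg ‖a - P a - (b - P b)‖]) (norm_nonneg _)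
  have hPuniq : ∀ p ∈ K, ∀ a, IsNormal K p a → P (p + a) = p := fun p hp a ha => by
    have h := norm_sub_sq_add_le_of_normal (hPn (p + a) _ hp) (ha _ (hPK (p + a)))
    simp only [add_sub_cancel, sub_self, norm_zero] at h
    have h0 : ‖P (p + a) - p‖ ^ 2 ≤ 0 := by
      nlinarith [sq_nonneg ‖p + a - P (p + a) - a‖]
    exact sub_eq_zero.1 (norm_eq_zero.1 (pow_eq_zero_iff (two_ne_zero)|>.1
      (le_antisymm h0 (sq_nonneg _))))
  have hPself : ∀ p ∈ K, P p = p := fun p hp => by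
    simpa using hPuniq p hp 0 (fun c _ => by simp)
  set T : ℂ → ℂ := fun w => ψ (P w) with hTdef
  have hT : ∀ a b, ‖T a - T b‖ ≤ ‖a - b‖ := fun a b =>
    (hle _ (hPK a) _ (hPK b)).trans (hPcontr a b)
  have hmemran : ∀ p ∈ K, ∀ a, IsNormal K p a →
      p + ψ p + a ∈ Set.range fun w => w + T w := fun p hp a ha =>
    ⟨p + a, by simp only [hTdef, hPuniq p hp a ha]; ring⟩
  have hDran : (fun w => w + ψ w) '' Ω ⊆ closure (Set.range fun w => w + T w) := by
    rintro _ ⟨w, hw, rfl⟩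
    exact subset_closure ⟨w, by simp only [hTdef, hPself w (hΩK hw)]⟩
  have hinner : ∀ q e : ℂ, (∀ v, ⟪v + T v - q, e⟫ ≤ 0) →
      ∀ x ∈ closure (Set.range fun w => w + T w), ⟪x - q, e⟫ ≤ 0 := fun q e h x hx => by
    have hcl : IsClosed {x : ℂ | ⟪x - q, e⟫ ≤ 0} := isClosed_le (by fun_prop) continuous_const
    exact closure_minimal (by rintro _ ⟨v, rfl⟩; exact h v) hcl hx
  have hstrict : ∀ a ∈ Ω, ∀ b ∈ K, a ≠ b → ‖ψ a - ψ b‖ < ‖a - b‖ := fun a ha b hb hab => by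
    -- The midpoint lies in `Ω` even if `b` is on the boundary, so half of the path is contracted
    -- strictly.
    set m : ℂ := (1 / 2 : ℝ) • a + (1 / 2 : ℝ) • b with hm
    have hmΩ : m ∈ Ω := by
      have := hconv.combo_interior_closure_mem_interior (hΩ.interior_eq.symm ▸ ha) hb
        (a := 1 / 2) (b := 1 / 2) (by norm_num) (by norm_num) (by norm_num)
      rwa [hΩ.interior_eq] at this
    have h1 : a - m = (1 / 2 : ℝ) • (a - b) := by rw [hm]; module
    have h2 : m - b = (1 / 2 : ℝ) • (a - b) := by rw [hm]; module
    have ham : a ≠ m := by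
      intro h
      rw [sub_eq_zero.2 h] at h1
      rcases smul_eq_zero.1 h1.symm with h | h
      · norm_num at h
      · exact hab (sub_eq_zero.1 h)
    have h3 := hlt a ha m hmΩ ham
    have h4 := hle m (hΩK hmΩ) b hb
    rw [h1, norm_smul] at h3
    rw [h2, norm_smul] at h4
    norm_num at h3 h4
    calc ‖ψ a - ψ b‖ ≤ ‖ψ a - ψ m‖ + ‖ψ m - ψ b‖ := norm_sub_le_norm_sub_add_norm_sub _ _ _
      _ < ‖a - b‖ := by linarith
  -- The first family consists of translated normal rays of `K`, the second of normal rays to the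
  -- closed range of `1 + T`.
  refine ⟨hD, ?_, {r | ‖r.2‖ = 1 ∧ ∃ p ∈ K, r.1 = p + ψ p ∧ IsNormal K p r.2} ∪
    {r | ‖r.2‖ = 1 ∧ r.1 ∈ closure (Set.range fun w => w + T w) ∧
      ∀ v, ⟪v + T v - r.1, r.2⟫ ≤ 0}, ?_, ?_, ?_⟩
  · refine IsConnected.image (hconv.isConnected hne) _ (continuousOn_id.add ?_)
    exact (LipschitzOnWith.of_dist_le_mul (K := 1) fun a ha b hb => by
      simpa [dist_eq_norm] using hle a (hΩK ha) b (hΩK hb)).continuousOn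
  · rintro r (hr | hr)
    exacts [hr.1, hr.1]
  · apply Set.Subset.antisymm
    · intro y hy
      rw [Set.mem_iUnion₂]
      by_cases hyr : y ∈ Set.range fun w => w + T w
      -- Here `w + T w = (P w + ψ (P w)) + (w - P w)`, and `w - P w` is normal at `P w`. If it
      -- vanishes, `w` is a boundary point and any supporting normal serves.
      · obtain ⟨w, rfl⟩ := hyr
        have hwΩ : P w ∉ Ω ∨ w ≠ P w := by
          by_contra! hcon
          exact hy ⟨w, hcon.2 ▸ hcon.1, by simp only [hTdef, ← hcon.2]⟩
        rcases eq_or_ne w (P w) with hw | hw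
        · obtain ⟨e, he, hen⟩ := exists_normal_of_notMem hΩ hconv hne
            (hwΩ.resolve_right (not_not.2 hw))
          refine ⟨(P w + ψ (P w), e), Or.inl ⟨he, P w, hPK w, rfl, isNormal_closure hen⟩, ?_⟩
          refine ⟨0, le_rfl, ?_⟩
          simp only [hTdef, ← hw]
          simp
        · have hpos : 0 < ‖w - P w‖ := norm_pos_iff.2 (sub_ne_zero.2 hw)
          refine ⟨(P w + ψ (P w), ‖w - P w‖⁻¹ • (w - P w)), Or.inl ⟨?_, P w, hPK w, rfl,
            (hPN w).smul (by positivity)⟩, ?_⟩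
          · rw [norm_smul, norm_inv, norm_norm, inv_mul_cancel₀ hpos.ne']
          · have := add_smul_mem_halfLine (P w + ψ (P w)) (‖w - P w‖⁻¹ • (w - P w)) hpos.le
            rw [smul_smul, mul_inv_cancel₀ hpos.ne', one_smul] at this
            convert! this using 1
            simp only [hTdef]; ring
      · obtain ⟨q, e, he, hq, hqe, s, hs, rfl⟩ := exists_outer_normal_of_notMem_range hT hyr
        exact ⟨(q, e), Or.inr ⟨he, hq, hqe⟩, add_smul_mem_halfLine q e hs⟩
    · intro y hy hyD
      obtain ⟨r, hr, hyr⟩ := Set.mem_iUnion₂.1 hy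
      obtain ⟨t, ht, rfl⟩ := exists_of_mem_halfLine hyr
      rcases hr with ⟨hr1, p, hp, hrp, hn⟩ | ⟨hr1, hrc, hrn⟩
      · obtain ⟨w, hw, hwe⟩ := hyD
        have hwe' : w + ψ w + 0 = p + ψ p + t • r.2 := by rw [add_zero, ← hrp]; exact hwe
        have h0 := IsNormal.eq_of_add_eq hle (hΩK hw) hp (fun c _ => by simp) (hn.smul ht) hwe'
        rw [← h0, add_zero, add_zero] at hwe'
        have hr0 : r.2 ≠ 0 := norm_ne_zero_iff.1 (by rw [hr1]; norm_num)
        have hwp : w ≠ p := by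
          rintro rfl
          have := inner_lt_of_isOpen (q := w) hΩ hr0
            (fun d hd => by rw [real_inner_comm]; exact hn d (hΩK hd)) hw
          simp at this
        have h1 := hstrict w hw p hp hwp
        have h2 : ψ w - ψ p = -(w - p) := by linear_combination hwe'
        rw [h2, norm_neg] at h1
        exact lt_irrefl _ h1
      · have hr0 : r.2 ≠ 0 := norm_ne_zero_iff.1 (by rw [hr1]; norm_num)
        have h1 := inner_lt_of_isOpen hD hr0
          (fun d hd => hinner r.1 r.2 hrn d (hDran hd)) hyD
        rw [add_sub_cancel_left, real_inner_smul_left, real_inner_self_eq_norm_sq] at h1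
        have := mul_nonneg ht (sq_nonneg ‖r.2‖)
        linarith
  · have hmix : ∀ r s : ℂ × ℂ, (∃ p ∈ K, r.1 = p + ψ p ∧ IsNormal K p r.2) →
        (‖s.2‖ = 1 ∧ s.1 ∈ closure (Set.range fun w => w + T w) ∧
          ∀ v, ⟪v + T v - s.1, s.2⟫ ≤ 0) →
        halfLine r.1 r.2 ∩ halfLine s.1 s.2 ⊆ {s.1} := by
      rintro r s ⟨p, hp, hrp, hn⟩ ⟨hs1, hsc, hsn⟩ w ⟨hw₁, hw₂⟩
      obtain ⟨t, ht, rfl⟩ := exists_of_mem_halfLine hw₁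
      obtain ⟨u, hu, hwu⟩ := exists_of_mem_halfLine hw₂
      -- Rays of the first family stay in the range of `1 + T`, which a ray of the second family
      -- leaves immediately after its origin.
      have hmem : r.1 + t • r.2 ∈ closure (Set.range fun w => w + T w) := by
        rw [hrp]; exact subset_closure (hmemran p hp _ (hn.smul ht))
      have h := hinner _ _ hsn _ hmem
      rw [hwu, add_sub_cancel_left, real_inner_smul_left, real_inner_self_eq_norm_sq, hs1,
        one_pow, mul_one] at h
      rw [hwu, le_antisymm h hu, zero_smul, add_zero]
      rfl
    rintro r (hr | hr) s (hs | hs) hrs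
    · obtain ⟨hr1, p, hp, hrp, hpn⟩ := hr
      obtain ⟨hs1, p', hp', hsp, hpn'⟩ := hs
      refine Or.inl (halfLine_inter_subset_of_smul_eq hr1 hs1 hrs fun t u ht hu h => ?_)
      rw [hrp, hsp] at h
      exact IsNormal.eq_of_add_eq hle hp hp' (hpn.smul ht) (hpn'.smul hu) h
    · exact Or.inr (hmix r s hr.2 hs)
    · exact Or.inl (Set.inter_comm _ _ ▸ hmix s r hs.2 hr)
    · refine Or.inl (halfLine_inter_subset_of_smul_eq hr.1 hs.1 hrs fun t u ht hu h => ?_)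
      have hsq := norm_sub_sq_add_le_of_normal (p₁ := r.1) (p₂ := s.1) (a₁ := t • r.2)
        (a₂ := u • s.2)
        (by rw [real_inner_smul_left, real_inner_comm]
            exact mul_nonpos_of_nonneg_of_nonpos ht (hinner _ _ hr.2.2 _ hs.2.1))
        (by rw [real_inner_smul_left, real_inner_comm]
            exact mul_nonpos_of_nonneg_of_nonpos hu (hinner _ _ hs.2.2 _ hr.2.1))
      rw [h, sub_self, norm_zero] at hsq
      have h0 : ‖t • r.2 - u • s.2‖ ^ 2 ≤ 0 := by nlinarith [sq_nonneg ‖r.1 - s.1‖]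
      exact sub_eq_zero.1 (norm_eq_zero.1 (pow_eq_zero_iff (two_ne_zero)|>.1
        (le_antisymm h0 (sq_nonneg _))))

/-- A nonexpansive map on a set agrees there with a map that is nonexpansive on the closure. -/
theorem exists_nonexpansive_closure_extension {Ω : Set ℂ} {ψ : ℂ → ℂ}
    (hle : ∀ a ∈ Ω, ∀ b ∈ Ω, ‖ψ a - ψ b‖ ≤ ‖a - b‖) :
    ∃ ψ' : ℂ → ℂ, Set.EqOn ψ ψ' Ω ∧
      ∀ a ∈ closure Ω, ∀ b ∈ closure Ω, ‖ψ' a - ψ' b‖ ≤ ‖a - b‖ := by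
  -- Extending real and imaginary parts separately may lose the constant 1 globally; on the closure
  -- it is recovered by continuity.
  have hre : LipschitzOnWith 1 (fun w => (ψ w).re) Ω :=
    LipschitzOnWith.of_dist_le_mul fun a ha b hb => by
      rw [dist_eq_norm, dist_eq_norm, NNReal.coe_one, one_mul, ← Complex.sub_re]
      exact (Complex.abs_re_le_norm _).trans (hle a ha b hb)
  have him : LipschitzOnWith 1 (fun w => (ψ w).im) Ω :=
    LipschitzOnWith.of_dist_le_mul fun a ha b hb => by
      rw [dist_eq_norm, dist_eq_norm, NNReal.coe_one, one_mul, ← Complex.sub_im]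
      exact (Complex.abs_im_le_norm _).trans (hle a ha b hb)
  obtain ⟨u, hu, hue⟩ := hre.extend_real
  obtain ⟨v, hv, hve⟩ := him.extend_real
  have hc : Continuous fun w => (u w : ℂ) + v w * Complex.I := by
    have := hu.continuous
    have := hv.continuous
    fun_prop
  have heq : Set.EqOn ψ (fun w => (u w : ℂ) + v w * Complex.I) Ω := fun w hw => by
    simp only
    rw [← hue hw, ← hve hw, Complex.re_add_im]
  refine ⟨_, heq, fun a ha b hb => ?_⟩
  have hcl : IsClosed {x : ℂ × ℂ | ‖((u x.1 : ℂ) + v x.1 * Complex.I) -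
      ((u x.2 : ℂ) + v x.2 * Complex.I)‖ ≤ ‖x.1 - x.2‖} :=
    isClosed_le ((hc.comp continuous_fst).sub (hc.comp continuous_snd)).norm
      (continuous_fst.sub continuous_snd).norm
  have hsub := closure_minimal (s := Ω ×ˢ Ω) (fun x hx => by
    have := hle x.1 hx.1 x.2 hx.2
    rwa [heq hx.1, heq hx.2] at this) hcl
  exact hsub (by rw [closure_prod_eq]; exact ⟨ha, hb⟩ : (a, b) ∈ closure (Ω ×ˢ Ω))

/-- The identity plus a strict contraction maps an open convex set onto a close-to-convex
domain, as soon as the image is open. -/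
theorem isCloseToConvexDomain_image {Ω : Set ℂ} (hΩ : IsOpen Ω) (hconv : Convex ℝ Ω)
    (hne : Ω.Nonempty) {ψ : ℂ → ℂ}
    (hlt : ∀ a ∈ Ω, ∀ b ∈ Ω, a ≠ b → ‖ψ a - ψ b‖ < ‖a - b‖)
    (hD : IsOpen ((fun w => w + ψ w) '' Ω)) :
    IsCloseToConvexDomain ((fun w => w + ψ w) '' Ω) := by
  obtain ⟨ψ', heq, hle'⟩ := exists_nonexpansive_closure_extension (Ω := Ω) (ψ := ψ)
    fun a ha b hb => by
      rcases eq_or_ne a b with rfl | hab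
      · simp
      · exact (hlt a ha b hb hab).le
  have himg : (fun w => w + ψ w) '' Ω = (fun w => w + ψ' w) '' Ω :=
    Set.image_congr fun w hw => by rw [heq hw]
  rw [himg] at hD ⊢
  exact isCloseToConvexDomain_image_of_closure hΩ hconv hne hle'
    (fun a ha b hb hab => by rw [← heq ha, ← heq hb]; exact hlt a ha b hb hab) hD

/-! ### The coefficient condition -/

theorem summable_norm_choose_mul_pow (a : ℝ) {z : ℂ} (hz : ‖z‖ < 1) :
    Summable fun n : ℕ => ‖((Ring.choose a n : ℝ) : ℂ) * z ^ n‖ := by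
  have h1 : z ∈ Metric.eball (0 : ℂ) (binomialSeries ℂ (a : ℂ)).radius := by
    refine Metric.eball_subset_eball (binomialSeries_radius_ge_one (𝕂 := ℂ)) ?_
    rw [← ENNReal.ofReal_one, Metric.eball_ofReal]
    simpa using hz
  refine ((binomialSeries ℂ (a : ℂ)).summable_norm_apply h1).congr fun n => ?_
  rw [binomialSeries_apply]
  simp [Complex.ofReal_choose]

/-- This is the nested Cauchy product form: the sign is absorbed into `(-z) ^ (k - j)`, and `w 0 =
0` allows the indices to start at 0. -/
theorem doubleSum_mul_pow (α β : ℝ) (w a : ℕ → ℂ) (hw : w 0 = 0) (z : ℂ) (n : ℕ) :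
    doubleSum α β w a n * z ^ n =
      ∑ k ∈ Finset.range (n + 1), (∑ j ∈ Finset.range (k + 1), (w j * a j * z ^ j) *
        (((Ring.choose α (k - j) : ℝ) : ℂ) * (-z) ^ (k - j))) *
        (((Ring.choose β (n - k) : ℝ) : ℂ) * z ^ (n - k)) := by
  have hsub : ∀ m : ℕ, Finset.Icc 1 m ⊆ Finset.range (m + 1) := fun m j hj => by
    simp only [Finset.mem_Icc, Finset.mem_range] at hj ⊢; omega
  have hzero : ∀ m : ℕ, ∀ j ∈ Finset.range (m + 1), j ∉ Finset.Icc 1 m → j = 0 :=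
    fun m j hj hj' => by
      simp only [Finset.mem_Icc, Finset.mem_range] at hj hj'; omega
  rw [← Finset.sum_subset (hsub n) fun k hk hk' => by
    rw [hzero n k hk hk']; simp [hw]]
  rw [doubleSum, Finset.sum_mul]
  refine Finset.sum_congr rfl fun k hk => ?_
  rw [← Finset.sum_subset (hsub k) fun j hj hj' => by rw [hzero k j hj hj']; simp [hw]]
  have hkn : z ^ n = z ^ k * z ^ (n - k) := by
    rw [← pow_add, Nat.add_sub_cancel' (Finset.mem_Icc.1 hk).2]
  rw [hkn, ← mul_assoc, mul_right_comm _ _ (z ^ k), mul_assoc, Finset.sum_mul]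
  congr 1
  refine Finset.sum_congr rfl fun j hj => ?_
  have hjk : z ^ k = z ^ j * z ^ (k - j) := by
    rw [← pow_add, Nat.add_sub_cancel' (Finset.mem_Icc.1 hj).2]
  rw [hjk, neg_pow z]
  ring

/-- The generating function of the double sums is a product of three series. -/
theorem hasSum_doubleSum (α β : ℝ) (w a : ℕ → ℂ) (hw : w 0 = 0) {z s : ℂ} (hz : ‖z‖ < 1)
    (hs : HasSum (fun n => w n * a n * z ^ n) s) :
    HasSum (fun n => doubleSum α β w a n * z ^ n)
      (s * (∑' n : ℕ, ((Ring.choose α n : ℝ) : ℂ) * (-z) ^ n) *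
        ∑' n : ℕ, ((Ring.choose β n : ℝ) : ℂ) * z ^ n) := by
  have h1 : Summable fun n => ‖w n * a n * z ^ n‖ := hs.summable.norm
  have h2 := summable_norm_choose_mul_pow α (z := -z) (by rwa [norm_neg])
  have h3 := summable_norm_choose_mul_pow β hz
  have h12 := summable_norm_sum_mul_range_of_summable_norm h1 h2
  have h123 := (summable_norm_sum_mul_range_of_summable_norm h12 h3).of_norm.hasSum
  rw [← tsum_mul_tsum_eq_tsum_sum_range_of_summable_norm h12 h3,
    ← tsum_mul_tsum_eq_tsum_sum_range_of_summable_norm h1 h2, hs.tsum_eq] at h123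
  refine h123.congr_fun fun n => ?_
  rw [doubleSum_mul_pow α β w a hw z n]

theorem doubleSum_zero (α β : ℝ) (w a : ℕ → ℂ) : doubleSum α β w a 0 = 0 := by
  simp [doubleSum]

theorem doubleSum_one (α β : ℝ) (w a : ℕ → ℂ) : doubleSum α β w a 1 = w 1 * a 1 := by
  simp [doubleSum]

theorem hasSum_add_two_doubleSum {α β : ℝ} {w a : ℕ → ℂ} {z s : ℂ}
    (hs : HasSum (fun n => doubleSum α β w a n * z ^ n) s) :
    HasSum (fun n => doubleSum α β w a (n + 2) * z ^ (n + 2)) (s - w 1 * a 1 * z) := by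
  have := (hasSum_nat_add_iff' 2).2 hs
  simpa [Finset.sum_range_succ, doubleSum_zero, doubleSum_one] using this

section Taylor

variable {h : ℂ → ℂ} (hh : DifferentiableOn ℂ h (Metric.ball 0 1)) {z : ℂ} (hz : ‖z‖ < 1)
include hh hz

theorem hasSum_taylorCoeff_deriv :
    HasSum (fun n : ℕ => (n : ℂ) * taylorCoeff h n * z ^ n) (z * deriv h z) := by
  have h1 := (Complex.hasSum_taylorSeries_on_ball (hh.deriv Metric.isOpen_ball)
    (z := z) (by simpa using hz)).mul_left z
  rw [← hasSum_nat_add_iff' 1]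
  simp only [Finset.range_one, Finset.sum_singleton, CharP.cast_eq_zero, zero_mul, sub_zero]
  refine h1.congr_fun fun n => ?_
  rw [taylorCoeff, iteratedDeriv_succ', Nat.factorial_succ, sub_zero, smul_eq_mul, smul_eq_mul]
  have h2 : (n.factorial : ℂ) ≠ 0 := Nat.cast_ne_zero.2 n.factorial_ne_zero
  have h3 : (n : ℂ) + 1 ≠ 0 := Nat.cast_add_one_ne_zero n
  push_cast
  field_simp
  ring

theorem hasSum_taylorCoeff_deriv_deriv :
    HasSum (fun n : ℕ => (n : ℂ) * ((n : ℂ) - 1) * taylorCoeff h n * z ^ n)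
      (z ^ 2 * deriv (deriv h) z) := by
  have h1 := (Complex.hasSum_taylorSeries_on_ball
    ((hh.deriv Metric.isOpen_ball).deriv Metric.isOpen_ball)
    (z := z) (by simpa using hz)).mul_left (z ^ 2)
  rw [← hasSum_nat_add_iff' 2]
  simp only [Finset.sum_range_succ, Finset.range_zero, Finset.sum_empty, CharP.cast_eq_zero,
    Nat.cast_one, sub_self, mul_zero, zero_mul, sub_zero, add_zero]
  refine h1.congr_fun fun n => ?_
  rw [taylorCoeff, iteratedDeriv_succ', iteratedDeriv_succ', Nat.factorial_succ,
    Nat.factorial_succ, sub_zero, smul_eq_mul, smul_eq_mul]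
  have h2 : (n.factorial : ℂ) ≠ 0 := Nat.cast_ne_zero.2 n.factorial_ne_zero
  have h3 : (n : ℂ) + 1 ≠ 0 := Nat.cast_add_one_ne_zero n
  have h4 : (n : ℂ) + 1 + 1 ≠ 0 := by exact_mod_cast Nat.cast_add_one_ne_zero (R := ℂ) (n + 1)
  push_cast
  field_simp
  ring

/-- The coefficient condition bounds `z h''` by `z h'' + 2 h'`. -/
theorem norm_mul_deriv_deriv_lt (h1 : deriv h 0 = 1) (α β : ℝ)
    (hsum : Summable fun n : ℕ => coeffTerm α β (taylorCoeff h) (n + 2))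
    (hle : ∑' n : ℕ, coeffTerm α β (taylorCoeff h) (n + 2) ≤ 2) :
    ‖z * deriv (deriv h) z‖ < ‖z * deriv (deriv h) z + 2 * deriv h z‖ := by
  rcases eq_or_ne z 0 with rfl | hz0
  · simp [h1]
  have hz0' : 0 < ‖z‖ := norm_pos_iff.2 hz0
  have hD := hasSum_taylorCoeff_deriv hh hz
  have hDD := hasSum_taylorCoeff_deriv_deriv hh hz
  have hP : HasSum (fun n : ℕ => (n : ℂ) * ((n : ℂ) + 1) * taylorCoeff h n * z ^ n)
      (z ^ 2 * deriv (deriv h) z + 2 * (z * deriv h z)) :=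
    (hDD.add (hD.mul_left 2)).congr_fun fun n => by ring
  have ha1 : taylorCoeff h 1 = 1 := by simp [taylorCoeff, iteratedDeriv_one, h1]
  have hX := hasSum_add_two_doubleSum (hasSum_doubleSum α β
    (fun j : ℕ => (j : ℂ) * ((j : ℂ) + 1)) _ (by simp) hz hP)
  have hY := hasSum_add_two_doubleSum (hasSum_doubleSum α β
    (fun j : ℕ => (j : ℂ) * ((j : ℂ) - 1)) _ (by simp) hz hDD)
  set A := ∑' n : ℕ, ((Ring.choose α n : ℝ) : ℂ) * (-z) ^ n
  set B := ∑' n : ℕ, ((Ring.choose β n : ℝ) : ℂ) * z ^ n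
  set X := (z ^ 2 * deriv (deriv h) z + 2 * (z * deriv h z)) * A * B with hXdef
  set Y := z ^ 2 * deriv (deriv h) z * A * B with hYdef
  simp only [ha1, Nat.cast_one, sub_self, mul_zero, zero_mul, sub_zero, mul_one, one_mul] at hX hY
  -- All remaining powers of `z` have exponent at least 2, hence the factor `‖z‖ ^ 2`, which beats
  -- the linear term since `‖z‖ < 1`.
  have hkey : ‖X - (1 + 1) * z‖ + ‖Y‖ ≤ 2 * ‖z‖ ^ 2 := by
    rw [← hX.tsum_eq, ← hY.tsum_eq]
    refine (add_le_add (norm_tsum_le_tsum_norm hX.summable.norm)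
      (norm_tsum_le_tsum_norm hY.summable.norm)).trans ?_
    rw [← hX.summable.norm.tsum_add hY.summable.norm]
    refine (Summable.tsum_le_tsum (fun n => ?_) (hX.summable.norm.add hY.summable.norm)
      (hsum.mul_right (‖z‖ ^ 2))).trans ?_
    · rw [norm_mul, norm_mul, ← add_mul, norm_pow, coeffTerm]
      exact mul_le_mul_of_nonneg_left
        (pow_le_pow_of_le_one (norm_nonneg _) hz.le (Nat.le_add_left 2 n)) (by positivity)
    · rw [tsum_mul_right]
      gcongr
  have hlt : ‖Y‖ < ‖X‖ := by
    have h2 : ‖(1 + 1) * z‖ = 2 * ‖z‖ := by rw [norm_mul]; norm_num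
    have h3 := norm_sub_norm_le ((1 + 1) * z) X
    rw [norm_sub_rev, h2] at h3
    nlinarith
  have hXe : X = z * A * B * (z * deriv (deriv h) z + 2 * deriv h z) := by rw [hXdef]; ring
  have hYe : Y = z * A * B * (z * deriv (deriv h) z) := by rw [hYdef]; ring
  -- Strictness makes a separate proof that `A` and `B` do not vanish unnecessary.
  rw [hXe, hYe, norm_mul, norm_mul (z * A * B)] at hlt
  exact lt_of_mul_lt_mul_left hlt (norm_nonneg _)

end Taylor

/-! ### Convexity of the analytic part -/

/-- If `|a| < |a + 2 b|`, then `b ≠ 0` and `Re (1 + a / b) > 0`. -/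
theorem re_one_add_div_pos {a b : ℂ} (hab : ‖a‖ < ‖a + 2 * b‖) : b ≠ 0 ∧ 0 < (1 + a / b).re := by
  have hb : b ≠ 0 := by rintro rfl; simp at hab
  refine ⟨hb, ?_⟩
  have h1 : a = a / b * b := (div_mul_cancel₀ a hb).symm
  have h2 : a + 2 * b = (a / b + 2) * b := by rw [add_mul, ← h1]
  rw [h2, norm_mul] at hab
  nth_rw 1 [h1] at hab
  rw [norm_mul] at hab
  have h3 := lt_of_mul_lt_mul_right hab (norm_nonneg b)
  have h4 : ‖a / b‖ ^ 2 < ‖a / b + 2‖ ^ 2 := by gcongr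
  rw [Complex.sq_norm, Complex.sq_norm, Complex.normSq_apply, Complex.normSq_apply] at h4
  simp only [Complex.add_re, Complex.add_im, Complex.re_ofNat, Complex.im_ofNat] at h4
  rw [Complex.add_re, Complex.one_re]
  nlinarith

/-- A curve whose velocity points inward stays for a short time in the ball through its
starting point. -/
theorem eventually_norm_lt_of_inner_neg {f : ℝ → ℂ} {f' : ℂ} (hf : HasDerivAt f f' 0)
    (h : ⟪f 0, f'⟫ < 0) : ∀ᶠ t in 𝓝[>] (0 : ℝ), ‖f t‖ < ‖f 0‖ := by
  have h1 := hf.norm_sq.tendsto_slope_zero_right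
  have h2 : 2 * ⟪f 0, f'⟫ < 0 := by linarith
  filter_upwards [h1.eventually (gt_mem_nhds h2), self_mem_nhdsWithin] with t ht htpos
  have htpos : 0 < t := htpos
  rw [zero_add, smul_eq_mul] at ht
  have h3 : ‖f t‖ ^ 2 - ‖f 0‖ ^ 2 < 0 := by
    by_contra! hcon
    have := mul_nonneg (inv_pos.2 htpos).le hcon
    linarith
  exact lt_of_pow_lt_pow_left₀ 2 (norm_nonneg _) (by linarith)

/-- A periodic function whose derivative has the sign of `-sin (Θ - Θ t₀)`, with `Θ` increasing
and making one turn over a period, has its strict maximum at `t₀`. -/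
theorem lt_of_deriv_eq_neg_sin {Θ u ρ : ℝ → ℝ} (hΘc : Continuous Θ) (hΘ : StrictMono Θ)
    {t₀ : ℝ} (hΘper : Θ (t₀ + 2 * Real.pi) = Θ t₀ + 2 * Real.pi)
    (hu : ∀ t, HasDerivAt u (-(ρ t * Real.sin (Θ t - Θ t₀))) t) (hρ : ∀ t, 0 < ρ t)
    (huper : u (t₀ + 2 * Real.pi) = u t₀) {t : ℝ} (h₁ : t₀ < t) (h₂ : t < t₀ + 2 * Real.pi) :
    u t < u t₀ := by
  have huc : Continuous u := continuous_iff_continuousAt.2 fun t => (hu t).continuousAt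
  have hpi := Real.pi_pos
  obtain ⟨t₁, ht₁, hΘ₁⟩ : Θ t₀ + Real.pi ∈ Θ '' Set.Icc t₀ (t₀ + 2 * Real.pi) :=
    intermediate_value_Icc (by linarith) hΘc.continuousOn ⟨by linarith, by linarith⟩
  rcases le_total t t₁ with h | h
  · have hanti : StrictAntiOn u (Set.Icc t₀ t₁) := by
      refine strictAntiOn_of_deriv_neg (convex_Icc _ _) huc.continuousOn fun x hx => ?_
      rw [interior_Icc] at hx
      rw [(hu x).deriv, neg_lt_zero]
      have := hΘ hx.1
      have := hΘ hx.2
      exact mul_pos (hρ x) (Real.sin_pos_of_pos_of_lt_pi (by linarith) (by linarith))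
    exact hanti ⟨le_rfl, h₁.le.trans h⟩ ⟨h₁.le, h⟩ h₁
  · have hmono : StrictMonoOn u (Set.Icc t₁ (t₀ + 2 * Real.pi)) := by
      refine strictMonoOn_of_deriv_pos (convex_Icc _ _) huc.continuousOn fun x hx => ?_
      rw [interior_Icc] at hx
      rw [(hu x).deriv, ← mul_neg]
      have h3 := hΘ hx.1
      have h4 := hΘ hx.2
      refine mul_pos (hρ x) ?_
      rw [← Real.sin_sub_pi]
      rw [hΘ₁] at h3
      rw [hΘper] at h4
      have h5 := Real.sin_pos_of_pos_of_lt_pi (x := Θ x - Θ t₀ - Real.pi) (by linarith)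
        (by linarith)
      exact h5
    rw [← huper]
    exact hmono ⟨h, h₂.le⟩ ⟨h.trans h₂.le, le_rfl⟩ h₂

section Convex

variable {h : ℂ → ℂ} (hh : DifferentiableOn ℂ h (Metric.ball 0 1))
  (hne : ∀ z ∈ Metric.ball (0 : ℂ) 1, deriv h z ≠ 0)

include hh in
theorem hasStrictDerivAt_of_mem_ball {z : ℂ} (hz : z ∈ Metric.ball (0 : ℂ) 1) :
    HasStrictDerivAt h (deriv h z) z :=
  (hh.analyticAt (Metric.isOpen_ball.mem_nhds hz)).hasStrictDerivAt

include hh hne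

theorem isOpen_image_of_deriv_ne_zero {s : Set ℂ} (hs : IsOpen s)
    (hsub : s ⊆ Metric.ball 0 1) : IsOpen (h '' s) := by
  rw [isOpen_iff_mem_nhds]
  rintro _ ⟨z, hz, rfl⟩
  rw [← (hasStrictDerivAt_of_mem_ball hh (hsub hz)).map_nhds_eq (hne z (hsub hz))]
  exact image_mem_map (hs.mem_nhds hz)

/-- A holomorphic logarithm of the derivative. -/
theorem exists_log_deriv : ∃ L : ℂ → ℂ, ∀ z ∈ Metric.ball (0 : ℂ) 1,
    HasDerivAt L (deriv (deriv h) z / deriv h z) z ∧ deriv h z = Complex.exp (L z) := by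
  have hd := hh.deriv Metric.isOpen_ball
  obtain ⟨L, hL0, hL⟩ := (((hd.deriv Metric.isOpen_ball).div hd hne).isExactOn_ball).with_val_at
    0 (Complex.log (deriv h 0))
  refine ⟨L, fun z hz => ⟨hL z hz, ?_⟩⟩
  -- `L` is a primitive of `h'' / h'`, so `h' exp (-L)` is constant.
  have hder : ∀ z ∈ Metric.ball (0 : ℂ) 1,
      HasDerivAt (fun z => deriv h z * Complex.exp (-L z)) 0 z := fun z hz => by
    have h1 := ((hd.differentiableAt (Metric.isOpen_ball.mem_nhds hz)).hasDerivAt).mul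
      (hL z hz).neg.cexp
    convert! h1 using 1
    have := hne z hz
    simp only [Pi.neg_apply, Pi.div_apply]
    field_simp
    ring
  have hconst := Metric.isOpen_ball.is_const_of_deriv_eq_zero
    (convex_ball (0 : ℂ) 1).isPreconnected
    (fun z hz => (hder z hz).differentiableAt.differentiableWithinAt)
    (fun z hz => (hder z hz).deriv) hz (Metric.mem_ball_self one_pos)
  have h0 := hne 0 (Metric.mem_ball_self one_pos)
  simp only [hL0, Complex.exp_neg, Complex.exp_log h0, mul_inv_cancel₀ h0] at hconst
  have hexp := Complex.exp_ne_zero (L z)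
  field_simp at hconst
  exact hconst

variable (hre : ∀ z ∈ Metric.ball (0 : ℂ) 1, 0 < (1 + z * deriv (deriv h) z / deriv h z).re)
include hre

/-- The image of a circle lies strictly on one side of each of its tangents. -/
theorem inner_tangent_neg_of_norm_eq {z ζ : ℂ} (hz : ‖z‖ < 1) (hζ : ‖ζ‖ = ‖z‖) (hne' : ζ ≠ z) :
    ⟪z * deriv h z, h ζ - h z⟫ < 0 := by
  obtain ⟨L, hL⟩ := exists_log_deriv hh hne
  set r := ‖z‖ with hr
  have hrpos : 0 < r := by
    rcases (norm_nonneg z).eq_or_lt with h0 | h0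
    · rw [← hr] at h0
      rw [← h0] at hr hζ
      rw [norm_eq_zero] at hζ
      exact absurd (hζ.trans (norm_eq_zero.1 hr.symm).symm) hne'
    · exact h0
  set c : ℝ → ℂ := fun t => r * Complex.exp (t * Complex.I) with hcdef
  have hcball : ∀ t, c t ∈ Metric.ball (0 : ℂ) 1 := fun t => by
    simp only [hcdef, mem_ball_zero_iff, norm_mul, Complex.norm_exp_ofReal_mul_I, mul_one,
      Complex.norm_real, Real.norm_of_nonneg hrpos.le]
    exact hz
  have hc : ∀ t, HasDerivAt c (c t * Complex.I) t := fun t => by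
    have h1 : HasDerivAt (fun t : ℝ => (t : ℂ) * Complex.I) (1 * Complex.I) t :=
      (Complex.ofRealCLM.hasDerivAt (x := t)).mul_const Complex.I
    convert! (h1.cexp).const_mul (r : ℂ) using 1
    simp only [hcdef]; ring
  have hcper : ∀ t, c (t + 2 * Real.pi) = c t := fun t => by
    simp only [hcdef]
    push_cast
    rw [add_mul, Complex.exp_add, Complex.exp_two_pi_mul_I, mul_one]
  have hcarg : ∀ w : ℂ, ‖w‖ = r → c w.arg = w := fun w hw => by
    simp only [hcdef, ← hw]
    exact Complex.norm_mul_exp_arg_mul_I w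
  have hLc : ∀ t, HasDerivAt (fun t => L (c t))
      (deriv (deriv h) (c t) / deriv h (c t) * (c t * Complex.I)) t := fun t =>
    (hL _ (hcball t)).1.comp_of_eq t (hc t) rfl
  -- `Θ` is a continuous argument of the outward normal `c h'(c)`. As `L ∘ c` is periodic, it gains
  -- exactly `2π` per turn.
  set Θ : ℝ → ℝ := fun t => t + (L (c t)).im with hΘdef
  have hΘ : ∀ t, HasDerivAt Θ (1 + c t * deriv (deriv h) (c t) / deriv h (c t)).re t := fun t => by
    have h1 := (hasDerivAt_id t).add (Complex.imCLM.hasFDerivAt.comp_hasDerivAt t (hLc t))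
    convert! h1 using 1
    have : deriv (deriv h) (c t) / deriv h (c t) * (c t * Complex.I) =
        (c t * deriv (deriv h) (c t) / deriv h (c t)) * Complex.I := by ring
    rw [this]
    simp
  have hΘmono : StrictMono Θ := strictMono_of_deriv_pos fun t => by
    rw [(hΘ t).deriv]; exact hre _ (hcball t)
  have hΘc : Continuous Θ := continuous_iff_continuousAt.2 fun t => (hΘ t).continuousAt
  set ρ : ℝ → ℝ := fun t => r * Real.exp (L (c t)).re with hρdef
  have hρ : ∀ t, 0 < ρ t := fun t => by simp only [hρdef]; positivity
  have htan : ∀ t, c t * deriv h (c t) = ρ t * Complex.exp (Θ t * Complex.I) := fun t => by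
    rw [(hL _ (hcball t)).2]
    simp only [hcdef, hρdef, hΘdef]
    nth_rw 1 [← Complex.re_add_im (L (r * Complex.exp (t * Complex.I)))]
    push_cast
    rw [add_mul, Complex.exp_add, Complex.exp_add]
    ring
  set t₀ := z.arg
  have hct₀ : c t₀ = z := hcarg z rfl
  obtain ⟨t, ht₁, ht₂, hct⟩ : ∃ t, t₀ < t ∧ t < t₀ + 2 * Real.pi ∧ c t = ζ := by
    have hζa := hcarg ζ hζ
    have h1 := Complex.neg_pi_lt_arg ζ
    have h2 := Complex.arg_le_pi ζ
    have h3 := Complex.neg_pi_lt_arg z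
    have h4 := Complex.arg_le_pi z
    rcases lt_trichotomy t₀ ζ.arg with h | h | h
    · exact ⟨ζ.arg, h, by linarith, hζa⟩
    · exact absurd (by rw [← hζa, ← h, hct₀]) hne'
    · exact ⟨ζ.arg + 2 * Real.pi, by linarith, by linarith, by rw [hcper, hζa]⟩
  -- The height of the image curve in the normal direction at `t₀`.
  set u : ℝ → ℝ := fun t => ⟪Complex.exp (Θ t₀ * Complex.I), h (c t)⟫ with hudef
  have hu : ∀ t, HasDerivAt u (-(ρ t * Real.sin (Θ t - Θ t₀))) t := fun t => by
    have h1 : HasDerivAt (fun t => h (c t)) (deriv h (c t) * (c t * Complex.I)) t :=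
      (hasStrictDerivAt_of_mem_ball hh (hcball t)).hasDerivAt.comp_of_eq t (hc t) rfl
    have h2 := (hasDerivAt_const t (Complex.exp (Θ t₀ * Complex.I))).inner ℝ h1
    convert! h2 using 1
    have h3 : deriv h (c t) * (c t * Complex.I) =
        ρ t * Complex.exp (Θ t * Complex.I) * Complex.I := by rw [← htan]; ring
    rw [inner_zero_left, add_zero, h3, Complex.inner, ← Complex.exp_conj, map_mul,
      Complex.conj_ofReal, Complex.conj_I]
    have h4 : Complex.exp (Θ t₀ * -Complex.I) *
        (ρ t * Complex.exp (Θ t * Complex.I) * Complex.I) =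
        ρ t * (Complex.exp (((Θ t - Θ t₀ : ℝ) : ℂ) * Complex.I) * Complex.I) := by
      have : ((Θ t - Θ t₀ : ℝ) : ℂ) * Complex.I = Θ t₀ * -Complex.I + Θ t * Complex.I := by
        push_cast; ring
      rw [this, Complex.exp_add]; ring
    rw [mul_comm (_ * Complex.I : ℂ), h4, Complex.re_ofReal_mul, Complex.mul_I_re, Complex.exp_ofReal_mul_I_im, mul_neg]
  have hlt := lt_of_deriv_eq_neg_sin hΘc hΘmono
    (by simp only [hΘdef, hcper]; ring) hu hρ (by simp only [hudef, hcper]) ht₁ ht₂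
  simp only [hudef, hct, hct₀] at hlt
  have htz := htan t₀
  rw [hct₀] at htz
  rw [htz, ← Complex.real_smul, real_inner_smul_left, inner_sub_right]
  exact mul_neg_of_pos_of_neg (hρ t₀) (by linarith)

/-- The image of a closed disk lies strictly on one side of each tangent of its boundary. -/
theorem inner_tangent_neg {z ζ : ℂ} (hz : ‖z‖ < 1) (hζ : ‖ζ‖ ≤ ‖z‖) (hne' : ζ ≠ z) :
    ⟪z * deriv h z, h ζ - h z⟫ < 0 := by
  rcases hζ.eq_or_lt with heq | hlt
  · exact inner_tangent_neg_of_norm_eq hh hne hre hz heq hne'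
  have hzpos : 0 < ‖z‖ := (norm_nonneg ζ).trans_lt hlt
  have hsub : Metric.closedBall (0 : ℂ) ‖z‖ ⊆ Metric.ball 0 1 :=
    Metric.closedBall_subset_ball hz
  set a := z * deriv h z with ha
  have ha0 : a ≠ 0 := mul_ne_zero (norm_pos_iff.1 hzpos) (hne z (by simpa using hz))
  have hle : ∀ w ∈ Metric.ball (0 : ℂ) ‖z‖, ⟪h w - h z, a⟫ ≤ 0 := fun w hw => by
    -- The modulus of this exponential is `exp ⟪h w - h z, a⟫`, so the maximum modulus principle
    -- carries the bound from the circle into the disk.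
    have hd : DiffContOnCl ℂ (fun w => Complex.exp ((h w - h z) * (starRingEnd ℂ) a))
        (Metric.ball 0 ‖z‖) := by
      apply DifferentiableOn.diffContOnCl
      rw [closure_ball _ hzpos.ne']
      exact (((hh.mono hsub).sub_const _).mul_const _).cexp
    have hmax := Complex.norm_le_of_forall_mem_frontier_norm_le Metric.isBounded_ball hd (C := 1)
      (fun v hv => by
        rw [frontier_ball _ hzpos.ne', mem_sphere_zero_iff_norm] at hv
        rw [Complex.norm_exp, Real.exp_le_one_iff, ← Complex.inner]
        rcases eq_or_ne v z with rfl | hvz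
        · simp
        · exact (inner_tangent_neg_of_norm_eq hh hne hre hz hv hvz).le)
      (subset_closure hw)
    rwa [Complex.norm_exp, Real.exp_le_one_iff, ← Complex.inner, real_inner_comm] at hmax
  rw [real_inner_comm]
  refine inner_lt_of_isOpen (D := h '' Metric.ball 0 ‖z‖)
    (isOpen_image_of_deriv_ne_zero hh hne Metric.isOpen_ball
      (Metric.ball_subset_closedBall.trans hsub)) ha0 ?_ ⟨ζ, by simpa using hlt, rfl⟩
  rintro _ ⟨w, hw, rfl⟩
  exact hle w hw

/-- Of two points, the tangent at the one of larger modulus strictly separates their images. -/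
theorem injOn_of_re_pos : Set.InjOn h (Metric.ball 0 1) := by
  have key : ∀ z ζ : ℂ, ‖z‖ < 1 → ‖ζ‖ ≤ ‖z‖ → h ζ = h z → ζ = z := fun z ζ hz hζ heq => by
    by_contra hcon
    have := inner_tangent_neg hh hne hre hz hζ hcon
    rw [heq, sub_self, inner_zero_right] at this
    exact lt_irrefl _ this
  intro a ha b hb hab
  rw [mem_ball_zero_iff] at ha hb
  rcases le_total ‖a‖ ‖b‖ with hle | hle
  · exact key b a hb hle hab
  · exact (key a b ha hle hab.symm).symm

/-- The classical convexity criterion: if `Re (1 + z h'' / h') > 0`, then `h` maps the disk onto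
a convex set. -/
theorem convex_image_of_re_pos : Convex ℝ (h '' Metric.ball 0 1) := by
  rw [convex_iff_segment_subset]
  rintro _ ⟨a, ha, rfl⟩ _ ⟨b, hb, rfl⟩ w hw
  rw [mem_ball_zero_iff] at ha hb
  set r := max ‖a‖ ‖b‖ with hr
  have hr1 : r < 1 := max_lt ha hb
  have hsub : Metric.closedBall (0 : ℂ) r ⊆ Metric.ball 0 1 := Metric.closedBall_subset_ball hr1
  -- Take the point of `h (closedBall 0 r)` nearest to `w`; if it is not `w`, a small move of `z`
  -- brings it closer.
  obtain ⟨z, hz, hmin⟩ := (isCompact_closedBall (0 : ℂ) r).exists_isMinOn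
    ⟨a, by simp [hr]⟩ (f := fun ζ => ‖h ζ - w‖)
    ((hh.continuousOn.mono hsub).sub continuousOn_const).norm
  refine ⟨z, hsub hz, ?_⟩
  by_contra hcon
  have hdir : ∀ d : ℂ, ⟪h z - w, deriv h z * d⟫ < 0 →
      ¬ ∀ᶠ t : ℝ in 𝓝[>] 0, z + t * d ∈ Metric.closedBall (0 : ℂ) r := fun d hd hev => by
    have h1 : HasDerivAt (fun t : ℝ => z + t * d) (1 * d) 0 :=
      ((Complex.ofRealCLM.hasDerivAt (x := (0 : ℝ))).mul_const d).const_add z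
    have h2 : HasDerivAt (fun t : ℝ => h (z + t * d) - w) (deriv h z * d) 0 := by
      have := ((hasStrictDerivAt_of_mem_ball hh (hsub hz)).hasDerivAt.comp_of_eq (0 : ℝ) h1
        (by simp)).sub_const w
      rwa [one_mul] at this
    have h3 := eventually_norm_lt_of_inner_neg h2 (by simpa using hd)
    obtain ⟨t, ht₁, ht₂⟩ := (h3.and hev).exists
    have := hmin ht₂
    simp only [Complex.ofReal_zero, zero_mul, add_zero, Set.mem_ofPred_eq] at ht₁ this
    linarith
  have hdz := hne z (hsub hz)
  have hwz : h z - w ≠ 0 := sub_ne_zero.2 hcon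
  have hnorm : 0 < ‖h z - w‖ ^ 2 := by positivity
  set d := -(h z - w) / deriv h z with hd
  have hdd : deriv h z * d = -(h z - w) := mul_div_cancel₀ _ hdz
  rw [mem_closedBall_zero_iff] at hz
  rcases hz.lt_or_eq with hlt | heq
  · refine hdir d ?_ ?_
    · rw [hdd, inner_neg_right, real_inner_self_eq_norm_sq]; linarith
    · have hcont : Continuous fun t : ℝ => z + t * d := by fun_prop
      have := (hcont.tendsto 0).mono_left (nhdsWithin_le_nhds (s := Set.Ioi 0))
      have hmem : z + ((0 : ℝ) : ℂ) * d ∈ Metric.ball (0 : ℂ) r := by simpa using hlt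
      exact (this.eventually (Metric.isOpen_ball.mem_nhds hmem)).mono
        fun t ht => Metric.ball_subset_closedBall ht
  · have hzero : z ≠ 0 ∨ a = b := by
      by_contra! h0
      rw [h0.1, norm_zero, hr] at heq
      have h1 := le_max_left ‖a‖ ‖b‖
      have h2 := le_max_right ‖a‖ ‖b‖
      rw [← heq, norm_le_zero_iff] at h1 h2
      exact h0.2 (h1.trans h2.symm)
    have hside : ∀ ζ, ‖ζ‖ ≤ r → ⟪z * deriv h z, h ζ - h z⟫ ≤ 0 := fun ζ hζ => by
      rcases eq_or_ne ζ z with rfl | hζz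
      · simp
      · exact (inner_tangent_neg hh hne hre (heq ▸ hr1) (heq ▸ hζ) hζz).le
    have hsidew : ⟪z * deriv h z, w - h z⟫ ≤ 0 := by
      obtain ⟨p, q, hp, hq, hpq, rfl⟩ := hw
      have : p • h a + q • h b - h z = p • (h a - h z) + q • (h b - h z) := by
        have : h z = p • h z + q • h z := by rw [← add_smul, hpq, one_smul]
        nth_rw 1 [this]
        module
      rw [this, inner_add_right, real_inner_smul_right, real_inner_smul_right]
      have h1 := mul_nonneg hp (neg_nonneg.2 (hside a (le_max_left _ _)))
      have h2 := mul_nonneg hq (neg_nonneg.2 (hside b (le_max_right _ _)))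
      linarith
    have hz0 : z ≠ 0 := by
      rcases hzero with h0 | rfl
      · exact h0
      · rintro rfl
        rw [segment_same, Set.mem_singleton_iff] at hw
        rw [norm_zero, hr, max_self] at heq
        rw [hw, norm_eq_zero.1 heq.symm] at hcon
        exact hcon rfl
    have hzd : ⟪z, d⟫ ≤ 0 := by
      have h1 : ⟪z * deriv h z, w - h z⟫ = ‖deriv h z‖ ^ 2 * ⟪z, d⟫ := by
        have : w - h z = deriv h z * d := by rw [hdd]; ring
        rw [this, Complex.inner, Complex.inner, map_mul, ← Complex.re_ofReal_mul]
        congr 1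
        push_cast
        rw [← Complex.conj_mul']
        ring
      rw [h1] at hsidew
      by_contra! hcon'
      have : 0 < ‖deriv h z‖ ^ 2 * ⟪z, d⟫ := mul_pos (by positivity) hcon'
      linarith
    -- On the boundary `d` may be tangential to the circle. Subtracting `z` makes it strictly inward
    -- and still decreases the distance, by `hsidew`.
    refine hdir (d - z) ?_ ?_
    · rw [mul_sub, hdd, inner_sub_right, inner_neg_right, real_inner_self_eq_norm_sq,
        mul_comm (deriv h z), real_inner_comm]
      rw [← neg_sub, inner_neg_right] at hsidew
      linarith
    · have h1 : HasDerivAt (fun t : ℝ => z + t * (d - z)) (1 * (d - z)) 0 :=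
        ((Complex.ofRealCLM.hasDerivAt (x := (0 : ℝ))).mul_const (d - z)).const_add z
      have h2 := eventually_norm_lt_of_inner_neg h1 (by
        have : 0 < ‖z‖ ^ 2 := by positivity
        simp only [Complex.ofReal_zero, zero_mul, add_zero, one_mul]
        rw [inner_sub_right, real_inner_self_eq_norm_sq]
        linarith)
      filter_upwards [h2] with t ht
      rw [mem_closedBall_zero_iff]
      simp only [Complex.ofReal_zero, zero_mul, add_zero, heq] at ht
      exact ht.le

end Convex

/-! ### Harmonic maps: Jacobian, dilatation and conclusion -/

/-- The real-linear map `v ↦ a v + conj (b v)`. -/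
noncomputable def harmonicDeriv (a b : ℂ) : ℂ →L[ℝ] ℂ :=
  a • (1 : ℂ →L[ℝ] ℂ) + (Complex.conjCLE : ℂ →L[ℝ] ℂ).comp (b • (1 : ℂ →L[ℝ] ℂ))

theorem harmonicDeriv_apply (a b v : ℂ) :
    harmonicDeriv a b v = a * v + (starRingEnd ℂ) (b * v) := by
  simp [harmonicDeriv]

theorem det_harmonicDeriv (a b : ℂ) : (harmonicDeriv a b).det = ‖a‖ ^ 2 - ‖b‖ ^ 2 := by
  have h : (harmonicDeriv a b).det = LinearMap.det (harmonicDeriv a b : ℂ →ₗ[ℝ] ℂ) := rfl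
  rw [h, ← LinearMap.det_toMatrix Complex.basisOneI, Matrix.det_fin_two]
  simp only [LinearMap.toMatrix_apply, ContinuousLinearMap.coe_coe, harmonicDeriv_apply,
    Complex.coe_basisOneI, Complex.coe_basisOneI_repr, Complex.sq_norm, Complex.normSq_apply]
  simp
  ring

theorem harmonicDeriv_surjective {a b : ℂ} (hab : ‖b‖ < ‖a‖) :
    Function.Surjective (harmonicDeriv a b) := by
  have hinj : Function.Injective (harmonicDeriv a b : ℂ →ₗ[ℝ] ℂ) := by
    rw [← LinearMap.ker_eq_bot, LinearMap.ker_eq_bot']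
    intro v hv
    rw [ContinuousLinearMap.coe_coe, harmonicDeriv_apply, add_eq_zero_iff_eq_neg] at hv
    have h := congrArg norm hv
    rw [norm_neg, RCLike.norm_conj, norm_mul, norm_mul] at h
    by_contra hv0
    exact hab.ne' (mul_right_cancel₀ (norm_ne_zero_iff.2 hv0) h)
  exact LinearMap.injective_iff_surjective.1 hinj

section Harmonic

variable {f h g : ℂ → ℂ} (hf : IsNormalizedHarmonic f h g)
include hf

theorem hasStrictFDerivAt_harmonic {z : ℂ} (hz : z ∈ unitDisk) :
    HasStrictFDerivAt f (harmonicDeriv (deriv h z) (deriv g z)) z := by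
  have h1 := (hf.analytic_h z hz).hasStrictDerivAt.complexToReal_fderiv
  have h2 := (hf.analytic_g z hz).hasStrictDerivAt.complexToReal_fderiv
  have h3 := h1.add ((Complex.conjCLE : ℂ →L[ℝ] ℂ).hasStrictFDerivAt.comp z h2)
  refine h3.congr_of_eventuallyEq ?_
  filter_upwards [Metric.isOpen_ball.mem_nhds hz] with w hw
  rw [hf.eq_add_conj w hw]
  simp

theorem jacobian_eq {z : ℂ} (hz : z ∈ unitDisk) :
    jacobian f z = ‖deriv h z‖ ^ 2 - ‖deriv g z‖ ^ 2 := by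
  rw [jacobian, (hasStrictFDerivAt_harmonic hf hz).hasFDerivAt.fderiv, det_harmonicDeriv]

/-- If the analytic part is an immersion, a locally univalent harmonic function with nonnegative
Jacobian has dilatation of modulus less than one. -/
theorem norm_deriv_lt_of_locallyUnivalent (hloc : LocallyUnivalent f)
    (hne : ∀ z ∈ unitDisk, deriv h z ≠ 0) (hJ : ∀ z ∈ unitDisk, 0 ≤ jacobian f z)
    {z : ℂ} (hz : z ∈ unitDisk) : ‖deriv g z‖ < ‖deriv h z‖ := by
  have hle : ∀ z ∈ unitDisk, ‖deriv g z‖ ≤ ‖deriv h z‖ := fun z hz => by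
    have := hJ z hz
    rw [jacobian_eq hf hz, sub_nonneg] at this
    exact le_of_sq_le_sq this (norm_nonneg _)
  refine (hle z hz).lt_of_ne fun heq => ?_
  have hconn : IsPreconnected unitDisk := (convex_ball (0 : ℂ) 1).isPreconnected
  have hopen : IsOpen unitDisk := Metric.isOpen_ball
  have h0 : (0 : ℂ) ∈ unitDisk := Metric.mem_ball_self one_pos
  have hdh := hf.analytic_h.differentiableOn.deriv hopen
  have hdg := hf.analytic_g.differentiableOn.deriv hopen
  have hmax : IsMaxOn (norm ∘ fun z => deriv g z / deriv h z) unitDisk z := fun w hw => by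
    simp only [Set.mem_ofPred_eq, Function.comp_apply, norm_div]
    rw [heq, div_self (norm_ne_zero_iff.2 (hne z hz))]
    exact div_le_one_of_le₀ (hle w hw) (norm_nonneg _)
  have hω := Complex.eqOn_of_isPreconnected_of_isMaxOn_norm hconn hopen (hdg.div hdh hne) hz hmax
  set c := deriv g z / deriv h z with hc
  have hcnorm : ‖c‖ = 1 := by rw [hc, norm_div, heq, div_self (norm_ne_zero_iff.2 (hne z hz))]
  have hgc : ∀ w ∈ unitDisk, deriv g w = c * deriv h w := fun w hw => by
    have : deriv g w / deriv h w = c := hω hw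
    rw [← this, div_mul_cancel₀ _ (hne w hw)]
  have hconst : ∀ w ∈ unitDisk, g w - c * h w = g 0 - c * h 0 := fun w hw => by
    refine hopen.is_const_of_deriv_eq_zero (f := fun w => g w - c * h w) hconn
      (hf.analytic_g.differentiableOn.sub (hf.analytic_h.differentiableOn.const_mul c)) ?_ hw h0
    intro v hv
    have h1 := ((hf.analytic_g v hv).differentiableAt.hasDerivAt).sub
      (((hf.analytic_h v hv).differentiableAt.hasDerivAt).const_mul c)
    rw [hgc v hv, sub_self] at h1
    exact h1.deriv
  have hfh : ∀ w ∈ unitDisk, f w = h w + (starRingEnd ℂ) (c * h w) := fun w hw => by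
    have hg0 : (starRingEnd ℂ) (g 0) = 0 := by
      have := hf.eq_add_conj 0 h0
      rwa [hf.f_zero, hf.h_zero, zero_add, eq_comm] at this
    have h1 := hconst w hw
    rw [hf.h_zero, mul_zero, sub_zero, (map_eq_zero _).1 hg0, sub_eq_zero] at h1
    rw [hf.eq_add_conj w hw, h1]
  -- With `|c| = 1`, the map `v ↦ v + conj (c v)` kills the real line spanned by `d` when `d² =
  -- -conj c`. Hence `f` vanishes wherever `h` takes values on that line, against injectivity near
  -- 0.
  obtain ⟨d, hd⟩ := IsAlgClosed.exists_pow_nat_eq (-(starRingEnd ℂ) c) two_pos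
  have hdn : ‖d‖ = 1 := by
    have := congrArg norm hd
    rw [norm_neg, RCLike.norm_conj, hcnorm, norm_pow] at this
    exact (pow_eq_one_iff_of_nonneg (norm_nonneg d) two_ne_zero).1 this
  have hdc : d + (starRingEnd ℂ) (c * d) = 0 := by
    have h1 : d * (starRingEnd ℂ) d = 1 := by rw [Complex.mul_conj', hdn]; norm_num
    rw [map_mul]
    linear_combination (-d) * h1 + (starRingEnd ℂ) d * hd
  obtain ⟨V, hVo, h0V, hVD, hVinj⟩ := hloc 0 h0
  have hnhds : h '' V ∈ 𝓝 (0 : ℂ) :=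
    (isOpen_image_of_deriv_ne_zero hf.analytic_h.differentiableOn hne hVo hVD).mem_nhds
      ⟨0, h0V, hf.h_zero⟩
  have hcont : Tendsto (fun t : ℝ => (t : ℂ) * d) (𝓝[>] 0) (𝓝 0) := by
    have : Continuous fun t : ℝ => (t : ℂ) * d := by fun_prop
    simpa using (this.tendsto 0).mono_left (nhdsWithin_le_nhds (s := Set.Ioi 0))
  obtain ⟨t, ⟨w, hwV, hwt⟩, ht⟩ := ((hcont.eventually hnhds).and self_mem_nhdsWithin).exists
  have ht : 0 < t := ht
  have hfw : f w = f 0 := by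
    rw [hfh w (hVD hwV), hf.f_zero, hwt]
    have : (t : ℂ) * d + (starRingEnd ℂ) (c * (t * d)) = t * (d + (starRingEnd ℂ) (c * d)) := by
      simp only [map_mul, Complex.conj_ofReal]; ring
    rw [this, hdc, mul_zero]
  have hw0 := hVinj hwV h0V hfw
  rw [hw0, hf.h_zero] at hwt
  rcases mul_eq_zero.1 hwt.symm with h1 | h1
  · exact ht.ne' (Complex.ofReal_eq_zero.1 h1)
  · rw [h1, norm_zero] at hdn
    exact zero_ne_one hdn

end Harmonic

/-- A holomorphic function on a convex set whose derivative has modulus less than one is a strict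
contraction. -/
theorem norm_sub_lt_of_norm_deriv_lt_one {Ω : Set ℂ} (hΩ : IsOpen Ω) (hconv : Convex ℝ Ω)
    {G : ℂ → ℂ} (hG : DifferentiableOn ℂ G Ω) (hlt : ∀ w ∈ Ω, ‖deriv G w‖ < 1) {a b : ℂ}
    (ha : a ∈ Ω) (hb : b ∈ Ω) (hab : a ≠ b) : ‖G a - G b‖ < ‖a - b‖ := by
  have hseg := hconv.segment_subset hb ha
  have hcomp : IsCompact (segment ℝ b a) := by
    rw [segment_eq_image_lineMap]
    exact isCompact_Icc.image AffineMap.lineMap_continuous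
  -- Compactness of the segment turns the pointwise bound into a uniform one below 1.
  obtain ⟨m, hm, hmax⟩ := hcomp.exists_isMaxOn ⟨b, left_mem_segment ℝ b a⟩
    (((hG.deriv hΩ).continuousOn.mono hseg).norm)
  have h1 := (convex_segment (𝕜 := ℝ) b a).norm_image_sub_le_of_norm_deriv_le
    (fun x hx => hG.differentiableAt (hΩ.mem_nhds (hseg hx))) (fun x hx => hmax hx)
    (left_mem_segment ℝ b a) (right_mem_segment ℝ b a)
  refine h1.trans_lt ?_
  have h2 := hlt m (hseg hm)
  have h3 : 0 < ‖a - b‖ := norm_pos_iff.2 (sub_ne_zero.2 hab)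
  exact mul_lt_of_lt_one_left h3 h2

/-- A harmonic function with dilatation of modulus less than one whose analytic part is univalent
with convex image is univalent, and its image is close-to-convex. -/
theorem mem_classCH_of_convex {f h g : ℂ → ℂ} (hf : IsNormalizedHarmonic f h g)
    (hlt : ∀ z ∈ unitDisk, ‖deriv g z‖ < ‖deriv h z‖) (hinj : Set.InjOn h unitDisk)
    (hconv : Convex ℝ (h '' unitDisk)) : f ∈ classCH := by
  have hne : ∀ z ∈ unitDisk, deriv h z ≠ 0 := fun z hz =>
    norm_pos_iff.1 ((norm_nonneg _).trans_lt (hlt z hz))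
  have hopen : IsOpen unitDisk := Metric.isOpen_ball
  have h0 : (0 : ℂ) ∈ unitDisk := Metric.mem_ball_self one_pos
  have hΩ : IsOpen (h '' unitDisk) :=
    isOpen_image_of_deriv_ne_zero hf.analytic_h.differentiableOn hne hopen subset_rfl
  set k := Function.invFunOn h unitDisk with hk
  have hkh : ∀ z ∈ unitDisk, k (h z) = z := fun z hz => hinj.leftInvOn_invFunOn hz
  have hkd : ∀ z ∈ unitDisk, HasDerivAt k (deriv h z)⁻¹ (h z) := fun z hz => by
    have hs := (hf.analytic_h z hz).hasStrictDerivAt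
    have hnz := hne z hz
    have hloc := (hs.to_localInverse hnz).hasDerivAt
    -- Near `h z` the global inverse coincides with the local one, whose derivative is known.
    refine hloc.congr_of_eventuallyEq ?_
    have h1 : Tendsto (hs.localInverse h (deriv h z) z hnz) (𝓝 (h z)) (𝓝 z) := by
      have h2 := hloc.continuousAt
      have h3 : hs.localInverse h (deriv h z) z hnz (h z) = z :=
        HasStrictFDerivAt.localInverse_apply_image _
      rwa [ContinuousAt, h3] at h2
    have h4 : ∀ᶠ w in 𝓝 (h z), h (hs.localInverse h (deriv h z) z hnz w) = w :=
      HasStrictFDerivAt.eventually_right_inverse _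
    filter_upwards [h1.eventually (hopen.mem_nhds hz), h4] with w hw₁ hw₂
    rw [← hkh _ hw₁, hw₂]
  have hGd : ∀ z ∈ unitDisk, HasDerivAt (fun w => g (k w)) (deriv g z * (deriv h z)⁻¹) (h z) :=
    fun z hz => (hf.analytic_g z hz).differentiableAt.hasDerivAt.comp_of_eq (h z) (hkd z hz)
      (hkh z hz).symm
  have hstrict : ∀ a ∈ h '' unitDisk, ∀ b ∈ h '' unitDisk, a ≠ b →
      ‖(starRingEnd ℂ) (g (k a)) - (starRingEnd ℂ) (g (k b))‖ < ‖a - b‖ := by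
    intro a ha b hb hab
    rw [← map_sub, RCLike.norm_conj]
    refine norm_sub_lt_of_norm_deriv_lt_one (G := fun w => g (k w)) hΩ hconv ?_ ?_ ha hb hab
    · rintro _ ⟨z, hz, rfl⟩
      exact (hGd z hz).differentiableAt.differentiableWithinAt
    · rintro _ ⟨z, hz, rfl⟩
      rw [(hGd z hz).deriv, norm_mul, norm_inv, ← div_eq_mul_inv, div_lt_one
        (norm_pos_iff.2 (hne z hz))]
      exact hlt z hz
  have hfe : ∀ z ∈ unitDisk, f z = h z + (starRingEnd ℂ) (g (k (h z))) := fun z hz => by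
    rw [hkh z hz, hf.eq_add_conj z hz]
  have himg : f '' unitDisk = (fun w => w + (starRingEnd ℂ) (g (k w))) '' (h '' unitDisk) := by
    rw [Set.image_image]
    exact Set.image_congr hfe
  have hfo : IsOpen (f '' unitDisk) := by
    rw [isOpen_iff_mem_nhds]
    rintro _ ⟨z, hz, rfl⟩
    rw [← (hasStrictFDerivAt_harmonic hf hz).map_nhds_eq_of_surj
      (LinearMap.range_eq_top.2 (harmonicDeriv_surjective (hlt z hz)))]
    exact image_mem_map (hopen.mem_nhds hz)
  refine ⟨⟨⟨h, g, hf⟩, ?_, ?_⟩, ?_⟩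
  · intro a ha b hb hab
    by_contra hcon
    have hne' : h a ≠ h b := fun heq => hcon (hinj ha hb heq)
    have h1 := hstrict _ ⟨a, ha, rfl⟩ _ ⟨b, hb, rfl⟩ hne'
    rw [hfe a ha, hfe b hb] at hab
    have h2 : (starRingEnd ℂ) (g (k (h a))) - (starRingEnd ℂ) (g (k (h b))) = -(h a - h b) := by
      linear_combination hab
    rw [h2, norm_neg] at h1
    exact lt_irrefl _ h1
  · intro z hz
    rw [jacobian_eq hf hz, sub_pos]
    exact pow_lt_pow_left₀ (hlt z hz) (norm_nonneg _) two_ne_zero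
  · rw [himg] at hfo ⊢
    exact isCloseToConvexDomain_image hΩ hconv ⟨h 0, 0, h0, rfl⟩
      (ψ := fun w => (starRingEnd ℂ) (g (k w))) hstrict hfo

end HarmonicCTC

theorem mainTheorem2 (f h g : ℂ → ℂ)
    (hf : HarmonicCTC.IsNormalizedHarmonic f h g)
    (hloc : HarmonicCTC.LocallyUnivalent f)
    (hsense : ∀ z ∈ HarmonicCTC.unitDisk, 0 ≤ HarmonicCTC.jacobian f z)
    (α β : ℝ)
    (hsum : Summable fun n : ℕ =>
      HarmonicCTC.coeffTerm α β (HarmonicCTC.taylorCoeff h) (n + 2))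
    (hle : ∑' n : ℕ, HarmonicCTC.coeffTerm α β (HarmonicCTC.taylorCoeff h) (n + 2) ≤ 2) :
    f ∈ HarmonicCTC.classCH := by
  have hh : DifferentiableOn ℂ h (Metric.ball 0 1) := hf.analytic_h.differentiableOn
  have hpos : ∀ z ∈ Metric.ball (0 : ℂ) 1,
      deriv h z ≠ 0 ∧ 0 < (1 + z * deriv (deriv h) z / deriv h z).re := fun z hz =>
    HarmonicCTC.re_one_add_div_pos (HarmonicCTC.norm_mul_deriv_deriv_lt hh
      (mem_ball_zero_iff.1 hz) hf.deriv_h_zero α β hsum hle)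
  have hne := fun z hz => (hpos z hz).1
  have hre := fun z hz => (hpos z hz).2
  exact HarmonicCTC.mem_classCH_of_convex hf
    (fun z hz => HarmonicCTC.norm_deriv_lt_of_locallyUnivalent hf hloc hne hsense hz)
    (HarmonicCTC.injOn_of_re_pos hh hne hre) (HarmonicCTC.convex_image_of_re_pos hh hne hre)
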